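/- Let $T:\mathbf{Set}\to\mathbf{Set}$ be a functor. An $n$-ary predicate lifting for $T$ is a family of maps $\lambda_X:(\mathcal P X)^n\to\mathcal P(TX)$, indexed by the sets $X$, that is natural with respect to preimages, i.e. $\lambda_X(f^{-1}[A_1],\dots,f^{-1}[A_n])=(Tf)^{-1}[\lambda_Y(A_1,\dots,A_n)]$ for all $f:X\to Y$ and $A_i\subseteq Y$. It is monotone if it preserves inclusion in every argument, and it preserves singletons if $|\lambda_X(\{x_1\},\dots,\{x_n\})|=1$ for all sets $X$ and all $x_1,\dots,x_n\in X$. Fix a set $\mathcal L$ of modalities with arities, and for each $n$-ary $L\in\mathcal L$ a monotone singleton-preserving $n$-ary predicate lifting $[\![L]\!]$ for $T$. Assume that $\{[\![L]\!]\mid L\in\mathcal L\}$ is strongly expressive: for every set $X$ and every $t\in TX$ there are an $n$-ary $L\in\mathcal L$ and $x_1,\dots,x_n\in X$ such that $\{t\}=[\![L]\!]_X(\{x_1\},\dots,\{x_n\})$. Fix a set $\mathsf V$ of fixed point variables. Expressions are the terms $\varphi::=z\mid\nu z.\,\varphi\mid L(\varphi_1,\dots,\varphi_n)$ with $z\in\mathsf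 V$ and $L\in\mathcal L$ of arity $n$ (not identified up to renaming of bound variables). An expression is closed if it has no free variables, and guarded if each bound variable is separated from its binding fixed point operator by at least one modality; $\mathcal E_0$ is the set of closed and guarded expressions. For a $T$-coalgebra $C=(X,\xi)$ and a valuation $\kappa:\mathsf V\to\mathcal P X$, the semantics is defined by $[\![z]\!]_C^\kappa=\kappa(z)$, $[\![L(\varphi_1,\dots,\varphi_n)]\!]_C^\kappa=\xi^{-1}\bigl[[\![L]\!]_X([\![\varphi_1]\!]_C^\kappa,\dots,[\![\varphi_n]\!]_C^\kappa)\bigr]$, and $[\![\nu z.\,\varphi]\!]_C^\kappa$ is the greatest fixed point of the monotone map $Y\mapsto[\![\varphi]\!]_C^{\kappa[z\mapsto Y]}$ on $\mathcal P X$. For closed $\varphi$ the valuation is immaterial, and one writes $[\![\varphi]\!]_C$. A $T$-coalgebra $\varepsilon:\mathcal E_0\to T\mathcal E_0$ is defined, by induction on the number of fixed point operators that are not in the scope of a modality, by letting $\varepsilon(L(\varphi_1,\dots,\varphi_n))$ be the unique element of $[\![L]\!]_{\mathcal E_0}(\{\varphi_1\},\dots,\{\varphi_n\})$ and putting $\varepsilon(\nu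 x.\,\varphi)=\varepsilon(\varphi[\nu x.\,\varphi/x])$. States $x$ of $C$ and $y$ of $D$ are behaviourally equivalent if there are a $T$-coalgebra $E$ and coalgebra morphisms $f:C\to E$ and $g:D\to E$ with $f(x)=g(y)$. Theorem. For every $\varphi\in\mathcal E_0$, every $T$-coalgebra $C$ and every state $x$ of $C$, one has $x\in[\![\varphi]\!]_C$ if and only if $x$ is behaviourally equivalent to $\varphi$ as a state of $(\mathcal E_0,\varepsilon)$. In particular, the truth lemma holds: $\varphi\in[\![\varphi]\!]_{(\mathcal E_0,\varepsilon)}$ for every $\varphi\in\mathcal E_0$. -/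

import Mathlib

open CategoryTheory

universe u

namespace CoalgExpr

/-! ## Predicate liftings -/

/-- An `n`-ary predicate lifting for a set functor `T`: a natural transformation from the `n`-th
power of the contravariant powerset functor to the contravariant powerset functor composed
with `T`. -/
structure PredicateLifting (T : Type u ⥤ Type u) (n : ℕ) where
  /-- The component at the set `X`. -/
  app : (X : Type u) → (Fin n → Set X) → Set (T.obj X)
  /-- Naturality with respect to preimages. -/
  naturality : ∀ {X Y : Type u} (f : X ⟶ Y) (A : Fin n → Set Y),
    app X (fun i => (fun x : X => f x) ⁻¹' (A i)) = (fun t : T.obj X => T.map f t) ⁻¹' (app Y A)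

namespace PredicateLifting

variable {T : Type u ⥤ Type u} {n : ℕ}

/-- A predicate lifting is monotone if it preserves inclusion in every argument. -/
def IsMonotone (lam : PredicateLifting T n) : Prop :=
  ∀ (X : Type u) (A B : Fin n → Set X), (∀ i, A i ⊆ B i) → lam.app X A ⊆ lam.app X B

/-- A predicate lifting preserves singletons if its value on any tuple of singletons has exactly
one element. -/
def PreservesSingletons (lam : PredicateLifting T n) : Prop :=
  ∀ (X : Type u) (x : Fin n → X), ∃ t : T.obj X, lam.app X (fun i => {x i}) = {t}

end PredicateLifting

/-- A set of predicate liftings (of various arities) is strongly expressive if every element of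
`T X` is singled out by one of them applied to singletons. -/
def StronglyExpressive {T : Type u ⥤ Type u} (Lam : Set (Σ n : ℕ, PredicateLifting T n)) : Prop :=
  ∀ (X : Type u) (t : T.obj X), ∃ l ∈ Lam, ∃ x : Fin l.1 → X,
    {t} = l.2.app X (fun i => {x i})

/-- A set of modalities with arities, each interpreted by a monotone singleton-preserving
predicate lifting of the same arity. -/
structure Modalities (T : Type u ⥤ Type u) where
  /-- The modalities. -/
  Symbol : Type u
  /-- Their arities. -/
  arity : Symbol → ℕ
  /-- Their interpretations. -/
  lifting : (l : Symbol) → PredicateLifting T (arity l)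
  monotone : ∀ l, (lifting l).IsMonotone
  preservesSingletons : ∀ l, (lifting l).PreservesSingletons

/-- The set of predicate liftings interpreting the modalities. -/
def Modalities.liftings {T : Type u ⥤ Type u} (M : Modalities T) :
    Set (Σ n : ℕ, PredicateLifting T n) :=
  Set.range fun l => ⟨M.arity l, M.lifting l⟩

/-! ## Expressions -/

/-- Expressions `φ ::= z | ν z. φ | L (φ₁, …, φₙ)` with fixed point variables `z ∈ V` and
modalities `L` of arity `n`. They are raw terms, not identified up to renaming. -/
inductive Expr (V : Type u) {T : Type u ⥤ Type u} (M : Modalities T) : Type u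
  | var (z : V) : Expr V M
  | nu (z : V) (φ : Expr V M) : Expr V M
  | modal (l : M.Symbol) (args : Fin (M.arity l) → Expr V M) : Expr V M

namespace Expr

variable {V : Type u} {T : Type u ⥤ Type u} {M : Modalities T}

/-- The free fixed point variables of an expression. -/
def freeVars : Expr V M → Set V
  | var z => {z}
  | nu z φ => freeVars φ \ {z}
  | modal _ args => ⋃ i, freeVars (args i)

/-- The variables with a free occurrence that is not in the scope of a modality. -/
def unguardedVars : Expr V M → Set V
  | var z => {z}
  | nu z φ => unguardedVars φ \ {z}
  | modal _ _ => ∅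

/-- An expression is closed if all its variables are bound. -/
def Closed (φ : Expr V M) : Prop := freeVars φ = ∅

/-- An expression is guarded if every bound variable is separated from its binding fixed point
operator by at least one modality. -/
def Guarded : Expr V M → Prop
  | var _ => True
  | nu z φ => z ∉ unguardedVars φ ∧ Guarded φ
  | modal _ args => ∀ i, Guarded (args i)

/-- `subst χ z φ` is `φ[χ/z]`: all free occurrences of `z` in `φ` are replaced by `χ`. It is used
only for closed `χ`, so that no variable can be captured. -/
def subst [DecidableEq V] (χ : Expr V M) (z : V) : Expr V M → Expr V M
  | var y => if y = z then χ else var y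
  | nu y φ => if y = z then nu y φ else nu y (subst χ z φ)
  | modal l args => modal l fun i => subst χ z (args i)

/-- The number of top-level fixed point operators, i.e. of those not in the scope of a
modality. -/
def topNu : Expr V M → ℕ
  | var _ => 0
  | nu _ φ => topNu φ + 1
  | modal _ _ => 0

theorem unguardedVars_subset (φ : Expr V M) : unguardedVars φ ⊆ freeVars φ := by
  induction φ with
  | var z => exact subset_rfl
  | nu z φ ih => exact Set.sdiff_subset_sdiff_left ih
  | modal l args ih => exact Set.empty_subset _

variable [DecidableEq V]

theorem freeVars_subst {χ : Expr V M} (hχ : Closed χ) (z : V) (φ : Expr V M) :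
    freeVars (subst χ z φ) ⊆ freeVars φ \ {z} := by
  induction φ with
  | var y =>
    by_cases h : y = z
    · simp only [subst, h, if_true]
      rw [show freeVars χ = ∅ from hχ]
      exact Set.empty_subset _
    · simp [subst, h, freeVars, Ne.symm h]
  | nu y φ ih =>
    by_cases h : y = z
    · subst h
      simp [subst, freeVars]
    · simp only [subst, h, if_false, freeVars]
      intro v hv
      exact ⟨⟨(ih hv.1).1, hv.2⟩, (ih hv.1).2⟩
  | modal l args ih =>
    simp only [subst, freeVars]
    intro v hv
    obtain ⟨i, hi⟩ := Set.mem_iUnion.1 hv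
    exact ⟨Set.mem_iUnion.2 ⟨i, (ih i hi).1⟩, (ih i hi).2⟩

theorem unguardedVars_subst {χ : Expr V M} (hχ : Closed χ) (z : V) (φ : Expr V M) :
    unguardedVars (subst χ z φ) ⊆ unguardedVars φ := by
  induction φ with
  | var y =>
    by_cases h : y = z
    · simp only [subst, h, if_true]
      refine (unguardedVars_subset χ).trans ?_
      rw [show freeVars χ = ∅ from hχ]
      exact Set.empty_subset _
    · simp [subst, h]
  | nu y φ ih =>
    by_cases h : y = z
    · simp [subst, h]
    · simp only [subst, h, if_false, unguardedVars]
      exact Set.sdiff_subset_sdiff_left ih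
  | modal l args ih => exact subset_rfl

theorem guarded_subst {χ : Expr V M} (hχ : Closed χ) (hg : Guarded χ) (z : V) (φ : Expr V M)
    (hφ : Guarded φ) : Guarded (subst χ z φ) := by
  induction φ with
  | var y =>
    by_cases h : y = z
    · simpa [subst, h] using hg
    · simpa [subst, h] using hφ
  | nu y φ ih =>
    by_cases h : y = z
    · simpa [subst, h] using hφ
    · simp only [subst, h, if_false]
      exact ⟨fun hy => hφ.1 (unguardedVars_subst hχ z φ hy), ih hφ.2⟩
  | modal l args ih => exact fun i => ih i (hφ i)

theorem topNu_subst (χ : Expr V M) (z : V) (φ : Expr V M) (hz : z ∉ unguardedVars φ) :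
    topNu (subst χ z φ) = topNu φ := by
  induction φ with
  | var y =>
    have h : y ≠ z := fun h => hz (by simp [unguardedVars, h])
    simp [subst, h]
  | nu y φ ih =>
    by_cases h : y = z
    · simp [subst, h]
    · simp only [subst, h, if_false, topNu]
      rw [ih fun hy => hz ⟨hy, fun e => h e.symm⟩]
  | modal l args ih => rfl

/-- The semantics of expressions in a `T`-coalgebra `C`, as a monotone function of the valuation
of the fixed point variables. The clause for `ν z. φ` is the greatest fixed point (in the complete
lattice of subsets of `C`) of the monotone map that sends `Y` to the semantics of `φ` under the
valuation updated by `z ↦ Y`. -/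
noncomputable def semHom (C : Endofunctor.Coalgebra T) : Expr V M → ((V → Set C.V) →o Set C.V)
  | var z => ⟨fun κ => κ z, fun _ _ h => h z⟩
  | nu z φ =>
    ⟨fun κ => OrderHom.gfp
        ⟨fun Y => semHom C φ (Function.update κ z Y), fun _ _ h =>
          (semHom C φ).monotone (update_le_update_iff.2 ⟨h, fun _ _ => le_rfl⟩)⟩,
      fun _ _ h => OrderHom.gfp.monotone fun _ =>
        (semHom C φ).monotone (update_le_update_iff.2 ⟨le_rfl, fun j _ => h j⟩)⟩
  | modal l args =>
    ⟨fun κ => (fun x : C.V => C.str x) ⁻¹'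
        ((M.lifting l).app C.V fun i => semHom C (args i) κ),
      fun _ _ h => Set.preimage_mono
        (M.monotone l C.V _ _ fun i => (semHom C (args i)).monotone h)⟩

/-- The semantics `⟦φ⟧` of the expression `φ` in the coalgebra `C` under the valuation `κ`. -/
noncomputable def sem (C : Endofunctor.Coalgebra T) (κ : V → Set C.V) (φ : Expr V M) : Set C.V :=
  semHom C φ κ

theorem sem_var (C : Endofunctor.Coalgebra T) (κ : V → Set C.V) (z : V) :
    sem C κ (var z : Expr V M) = κ z := rfl

theorem sem_modal (C : Endofunctor.Coalgebra T) (κ : V → Set C.V) (l : M.Symbol)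
    (args : Fin (M.arity l) → Expr V M) :
    sem C κ (modal l args) =
      (fun x : C.V => C.str x) ⁻¹' ((M.lifting l).app C.V fun i => sem C κ (args i)) := rfl

theorem sem_nu (C : Endofunctor.Coalgebra T) (κ : V → Set C.V) (z : V) (φ : Expr V M) :
    IsGreatest {Y | sem C (Function.update κ z Y) φ = Y} (sem C κ (nu z φ)) :=
  OrderHom.isGreatest_gfp
    (⟨fun Y => semHom C φ (Function.update κ z Y), fun _ _ h =>
      (semHom C φ).monotone (update_le_update_iff.2 ⟨h, fun _ _ => le_rfl⟩)⟩ :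
      Set C.V →o Set C.V)

end Expr

/-! ## The coalgebra of closed and guarded expressions -/

section

variable (V : Type u) {T : Type u ⥤ Type u} (M : Modalities T)

/-- The set `E₀` of closed and guarded expressions. -/
def ClosedGuarded : Type u := {φ : Expr V M // φ.Closed ∧ φ.Guarded}

end

namespace ClosedGuarded

variable {V : Type u} {T : Type u ⥤ Type u} {M : Modalities T}

/-- An argument of a modality in a closed and guarded expression. -/
def arg (l : M.Symbol) (args : Fin (M.arity l) → Expr V M)
    (h : (Expr.modal l args).Closed ∧ (Expr.modal l args).Guarded) (i : Fin (M.arity l)) :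
    ClosedGuarded V M :=
  ⟨args i, Set.iUnion_eq_empty.1 h.1 i, h.2 i⟩

variable [DecidableEq V]

theorem unfold_mem {x : V} {φ : Expr V M} (h : (Expr.nu x φ).Closed ∧ (Expr.nu x φ).Guarded) :
    (Expr.subst (Expr.nu x φ) x φ).Closed ∧ (Expr.subst (Expr.nu x φ) x φ).Guarded :=
  ⟨Set.subset_empty_iff.1 ((Expr.freeVars_subst h.1 x φ).trans (Set.subset_empty_iff.2 h.1)),
    Expr.guarded_subst h.1 h.2 x φ h.2.2⟩

/-- The unfolding `φ[ν x. φ / x]` of a closed and guarded expression `ν x. φ`. -/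
def unfold (x : V) (φ : Expr V M) (h : (Expr.nu x φ).Closed ∧ (Expr.nu x φ).Guarded) :
    ClosedGuarded V M :=
  ⟨Expr.subst (Expr.nu x φ) x φ, unfold_mem h⟩

/-- The coalgebra structure on `E₀`: on `L (φ₁, …, φₙ)` it is the only element of the
interpretation of `L` applied to `{φ₁}, …, {φₙ}`, and on `ν x. φ` it is its value on the unfolding
`φ[ν x. φ / x]`. The number of top-level fixed point operators decreases in each unfolding. -/
noncomputable def eps : ClosedGuarded V M → T.obj (ClosedGuarded V M)
  | ⟨.var z, h⟩ => False.elim (Set.singleton_ne_empty z h.1)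
  | ⟨.modal l args, h⟩ =>
    (M.preservesSingletons l (ClosedGuarded V M) (arg l args h)).choose
  | ⟨.nu x φ, h⟩ => eps (unfold x φ h)
termination_by φ => φ.1.topNu
decreasing_by
  simp only [unfold, Expr.topNu]
  rw [Expr.topNu_subst _ _ _ h.2.1]
  exact Nat.lt_succ_self _

theorem eps_modal (l : M.Symbol) (args : Fin (M.arity l) → Expr V M)
    (h : (Expr.modal l args).Closed ∧ (Expr.modal l args).Guarded) :
    eps ⟨Expr.modal l args, h⟩ ∈
      (M.lifting l).app (ClosedGuarded V M) (fun i => {arg l args h i}) := by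
  have hs := (M.preservesSingletons l (ClosedGuarded V M) (arg l args h)).choose_spec
  rw [eps]
  exact hs.ge (Set.mem_singleton _)

theorem eps_nu (x : V) (φ : Expr V M) (h : (Expr.nu x φ).Closed ∧ (Expr.nu x φ).Guarded) :
    eps ⟨Expr.nu x φ, h⟩ = eps (unfold x φ h) := by
  rw [eps]

end ClosedGuarded

/-- The `T`-coalgebra `(E₀, ε)` of closed and guarded expressions. -/
noncomputable def exprCoalgebra (V : Type u) [DecidableEq V] {T : Type u ⥤ Type u}
    (M : Modalities T) : Endofunctor.Coalgebra T where
  V := ClosedGuarded V M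
  str := TypeCat.ofHom ClosedGuarded.eps

/-! ## Behavioural equivalence -/

/-- States `x` of `C` and `y` of `D` are behaviourally equivalent if they can be identified by
coalgebra morphisms into a common coalgebra. -/
def BehaviourallyEquivalent {T : Type u ⥤ Type u} {C D : Endofunctor.Coalgebra T}
    (x : C.V) (y : D.V) : Prop :=
  ∃ (E : Endofunctor.Coalgebra T) (f : C ⟶ E) (g : D ⟶ E), f.f x = g.f y

end CoalgExpr

namespace CoalgExpr

/-! ### Semantics: coinduction, substitution, invariance under morphisms -/

namespace Expr

variable {V : Type u} {T : Type u ⥤ Type u} {M : Modalities T} [DecidableEq V]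

/-! From satisfaction to equivalence, glue `C` and `E₀` by identifying `x` with `φ` whenever `x ∈
⟦φ⟧`. The quotient is a coalgebra because a lifting applied to singletons has one element, so
related states have the same image under `T` (`map_str_eq_map_eps`).

Conversely, semantics is invariant under morphisms (`sem_preimage`), so it suffices that `φ`
satisfies itself. This truth lemma is proved for closed substitution instances of open expressions
(`simulSubst_mem_sem`), by structural induction with coinduction at `ν`. -/

theorem subset_sem_nu {C : Endofunctor.Coalgebra T} {κ : V → Set C.V} {z : V} {φ : Expr V M}
    {Y : Set C.V} (h : Y ⊆ sem C (Function.update κ z Y) φ) : Y ⊆ sem C κ (nu z φ) :=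
  OrderHom.le_gfp
    (⟨fun Y => semHom C φ (Function.update κ z Y), fun _ _ h =>
      (semHom C φ).monotone (update_le_update_iff.2 ⟨h, fun _ _ => le_rfl⟩)⟩ :
      Set C.V →o Set C.V) h

theorem sem_mono (C : Endofunctor.Coalgebra T) (φ : Expr V M) {κ κ' : V → Set C.V}
    (h : κ ≤ κ') : sem C κ φ ⊆ sem C κ' φ :=
  (semHom C φ).monotone h

theorem sem_update_mono (C : Endofunctor.Coalgebra T) (φ : Expr V M) (κ : V → Set C.V) (z : V)
    {Y Z : Set C.V} (h : Y ⊆ Z) :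
    sem C (Function.update κ z Y) φ ⊆ sem C (Function.update κ z Z) φ :=
  sem_mono C φ (update_le_update_iff.2 ⟨h, fun _ _ => le_rfl⟩)

theorem sem_nu_unfold (C : Endofunctor.Coalgebra T) (κ : V → Set C.V) (z : V) (φ : Expr V M) :
    sem C (Function.update κ z (sem C κ (nu z φ))) φ = sem C κ (nu z φ) :=
  (sem_nu C κ z φ).1

theorem sem_nu_congr {C : Endofunctor.Coalgebra T} {κ κ' : V → Set C.V} {z : V}
    {φ φ' : Expr V M}
    (h : ∀ Y, sem C (Function.update κ z Y) φ = sem C (Function.update κ' z Y) φ') :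
    sem C κ (nu z φ) = sem C κ' (nu z φ') := by
  refine (sem_nu C κ z φ).unique ?_
  simpa only [h] using sem_nu C κ' z φ'

theorem sem_congr (C : Endofunctor.Coalgebra T) (φ : Expr V M) {κ κ' : V → Set C.V}
    (h : ∀ v ∈ freeVars φ, κ v = κ' v) : sem C κ φ = sem C κ' φ := by
  induction φ generalizing κ κ' with
  | var z => exact h z rfl
  | nu z φ ih =>
    refine sem_nu_congr fun Y => ih fun v hv => ?_
    by_cases hvz : v = z
    · subst hvz; simp
    · simpa [hvz] using h v ⟨hv, hvz⟩
  | modal l args ih =>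
    rw [sem_modal, sem_modal]
    congr 2
    funext i
    exact ih i fun v hv => h v (Set.mem_iUnion.2 ⟨i, hv⟩)

theorem sem_eq_of_closed (C : Endofunctor.Coalgebra T) {φ : Expr V M} (hφ : Closed φ)
    (κ κ' : V → Set C.V) : sem C κ φ = sem C κ' φ :=
  sem_congr C φ fun v hv => by rw [show freeVars φ = ∅ from hφ] at hv; exact hv.elim

theorem sem_subst (C : Endofunctor.Coalgebra T) {χ : Expr V M} (hχ : Closed χ) (z : V)
    (φ : Expr V M) (κ : V → Set C.V) :
    sem C κ (subst χ z φ) = sem C (Function.update κ z (sem C κ χ)) φ := by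
  induction φ generalizing κ with
  | var y =>
    by_cases h : y = z
    · subst h; simp [subst, sem_var]
    · simp [subst, h, sem_var]
  | nu y φ ih =>
    by_cases h : y = z
    · subst h
      rw [subst, if_pos rfl]
      exact sem_nu_congr fun Y => by rw [Function.update_idem]
    · rw [subst, if_neg h]
      refine sem_nu_congr fun Y => ?_
      rw [ih, sem_eq_of_closed C hχ (Function.update κ y Y) κ, Function.update_comm h]
  | modal l args ih =>
    rw [subst, sem_modal, sem_modal]
    congr 2
    funext i
    exact ih i κ

/-- The semantics is invariant under coalgebra morphisms. -/
theorem sem_preimage {C D : Endofunctor.Coalgebra T} (f : C ⟶ D) (φ : Expr V M)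
    (κ : V → Set D.V) :
    sem C (fun v => (fun x : C.V => f.f x) ⁻¹' κ v) φ =
      (fun x : C.V => f.f x) ⁻¹' sem D κ φ := by
  have upd : ∀ (κ : V → Set D.V) (z : V) (Y : Set D.V),
      Function.update (fun v => (fun x : C.V => f.f x) ⁻¹' κ v) z ((fun x : C.V => f.f x) ⁻¹' Y) =
        fun v => (fun x : C.V => f.f x) ⁻¹' Function.update κ z Y v := by
    intro κ z Y
    funext v
    by_cases h : v = z
    · subst h; simp
    · simp [h]
  induction φ generalizing κ with
  | var z => rfl
  | nu z φ ih =>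
    apply subset_antisymm
    -- The direct image of the fixed point in `C` is a post-fixed point in `D`, since a set lies in
    -- the preimage of its image.
    · rw [← Set.image_subset_iff]
      apply subset_sem_nu
      rw [Set.image_subset_iff, ← ih, ← upd]
      conv_lhs => rw [← sem_nu_unfold]
      exact sem_update_mono C φ _ z (Set.subset_preimage_image _ _)
    -- The preimage of the fixed point in `D` is a post-fixed point in `C`.
    · apply subset_sem_nu
      rw [upd, ih, sem_nu_unfold]
  | modal l args ih =>
    have hf : ∀ x : C.V, T.map f.f (C.str x) = D.str (f.f x) := fun x =>
      ConcreteCategory.congr_hom f.h x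
    rw [sem_modal, sem_modal]
    simp only [ih]
    rw [(M.lifting l).naturality f.f]
    ext x
    simp only [Set.mem_preimage, hf]

theorem subst_eq_self (χ : Expr V M) (z : V) (φ : Expr V M) (hz : z ∉ freeVars φ) :
    subst χ z φ = φ := by
  induction φ with
  | var y =>
    have h : y ≠ z := fun h => hz h.symm
    simp [subst, h]
  | nu y φ ih =>
    by_cases h : y = z
    · simp [subst, h]
    · rw [subst, if_neg h, ih fun hy => hz ⟨hy, fun e => h e.symm⟩]
  | modal l args ih =>
    rw [subst]
    congr 1
    funext i
    exact ih i fun hi => hz (Set.mem_iUnion.2 ⟨i, hi⟩)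

/-! ### Simultaneous substitution and saturation under equal transition structure -/

/-- Simultaneous substitution of `σ v` for the free occurrences of each variable `v`. It is used
only when each `σ v` is closed or equal to `v`, so that no variable can be captured. -/
def simulSubst : (V → Expr V M) → Expr V M → Expr V M
  | σ, var z => σ z
  | σ, nu z φ => nu z (simulSubst (Function.update σ z (var z)) φ)
  | σ, modal l args => modal l fun i => simulSubst σ (args i)

theorem simulSubst_var (φ : Expr V M) : simulSubst var φ = φ := by
  induction φ with
  | var z => rfl
  | nu z φ ih => rw [simulSubst, Function.update_eq_self, ih]
  | modal l args ih => simp only [simulSubst, ih]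

/-- Only the placeholder `var z` is affected, as the other values of `σ` are closed or are other
variables. Hence unfolding an instance of `ν z. φ` gives an instance of `φ`, which keeps the truth
lemma structural. -/
theorem subst_simulSubst {χ : Expr V M} (z : V) (φ : Expr V M) (σ : V → Expr V M)
    (hσ : ∀ v, σ v = var v ∨ Closed (σ v)) :
    subst χ z (simulSubst (Function.update σ z (var z)) φ) =
      simulSubst (Function.update σ z χ) φ := by
  induction φ generalizing σ with
  | var y =>
    by_cases h : y = z
    · subst h; simp [simulSubst, subst]
    · simp only [simulSubst, Function.update_of_ne h]
      rcases hσ y with hy | hy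
      · simp [hy, subst, h]
      · exact subst_eq_self _ _ _ (by rw [show freeVars (σ y) = ∅ from hy]; exact id)
  | nu y φ ih =>
    by_cases h : y = z
    · subst h
      simp [simulSubst, subst]
    · rw [simulSubst, simulSubst, subst, if_neg h, Function.update_comm (Ne.symm h), ih,
        Function.update_comm h]
      intro v
      by_cases hv : v = y
      · subst hv; simp
      · simpa [hv] using hσ v
  | modal l args ih =>
    simp only [simulSubst, subst]
    congr 1
    funext i
    exact ih i σ hσ

/-- The semantics does not distinguish states with the same transition structure, provided that
the valuation does not. -/
theorem mem_sem_of_str_eq (C : Endofunctor.Coalgebra T) (φ : Expr V M) (κ : V → Set C.V)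
    (hκ : ∀ v, ∀ x y : C.V, C.str x = C.str y → x ∈ κ v → y ∈ κ v) {x y : C.V}
    (hxy : C.str x = C.str y) (hx : x ∈ sem C κ φ) : y ∈ sem C κ φ := by
  induction φ generalizing κ x y with
  | var z => exact hκ z x y hxy hx
  | nu z φ ih =>
    -- The fixed point is not yet known to be saturated, as the induction hypothesis requires, so
    -- its saturation `Y` is shown to be a post-fixed point.
    let Y : Set C.V := {y | ∃ x ∈ sem C κ (nu z φ), C.str x = C.str y}
    have hY : Y ⊆ sem C κ (nu z φ) := by
      apply subset_sem_nu
      rintro y ⟨x, hx, hxy⟩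
      refine ih (Function.update κ z Y) ?_ hxy ?_
      · intro v a b hab
        by_cases hv : v = z
        · subst hv
          rw [Function.update_self]
          rintro ⟨c, hc, hca⟩
          exact ⟨c, hc, hca.trans hab⟩
        · rw [Function.update_of_ne hv]
          exact hκ v a b hab
      · rw [← sem_nu_unfold] at hx
        exact sem_update_mono C φ κ z (show sem C κ (nu z φ) ⊆ Y from fun a ha => ⟨a, ha, rfl⟩) hx
    exact hY (show y ∈ Y from ⟨x, hx, hxy⟩)
  | modal l args ih =>
    rw [sem_modal, Set.mem_preimage] at hx ⊢
    rwa [← hxy]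

end Expr

open CoalgExpr.Expr

variable {V : Type u} {T : Type u ⥤ Type u} {M : Modalities T}

theorem mem_of_val_eq {S : Set (ClosedGuarded V M)} {φ ψ : ClosedGuarded V M} (h : φ.1 = ψ.1)
    (hφ : φ ∈ S) : ψ ∈ S := by
  rwa [← show φ = ψ from Subtype.ext h]

variable [DecidableEq V]

/-! ### The truth lemma -/

theorem simulSubst_mem_sem (φ : Expr V M) (σ : V → Expr V M)
    (κ : V → Set (exprCoalgebra V M).V)
    (hκ : ∀ v, ∀ χ χ' : ClosedGuarded V M, χ.eps = χ'.eps → χ ∈ κ v → χ' ∈ κ v)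
    (hσ : ∀ v, σ v = var v ∨ ∃ h, (⟨σ v, h⟩ : ClosedGuarded V M) ∈ κ v)
    (h : (simulSubst σ φ).Closed ∧ (simulSubst σ φ).Guarded) :
    (⟨simulSubst σ φ, h⟩ : ClosedGuarded V M) ∈ sem (exprCoalgebra V M) κ φ := by
  induction φ generalizing σ κ with
  | var z =>
    rcases hσ z with hz | ⟨_, hz⟩
    · have hc : (σ z).Closed := h.1
      rw [hz] at hc
      exact (Set.singleton_ne_empty z hc).elim
    · exact hz
  | nu z φ ih =>
    have h' : (nu z (simulSubst (Function.update σ z (var z)) φ)).Closed ∧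
      (nu z (simulSubst (Function.update σ z (var z)) φ)).Guarded := h
    -- The coinduction candidate: the singleton of the fixed point expression, enlarged to all
    -- states with the same `ε`-value so that it is saturated and also contains the unfolding.
    let Y : Set (exprCoalgebra V M).V :=
      {χ | ClosedGuarded.eps (⟨nu z (simulSubst (Function.update σ z (var z)) φ), h'⟩ :
        ClosedGuarded V M) = ClosedGuarded.eps χ}
    have hκY : ∀ v, ∀ χ χ' : ClosedGuarded V M, χ.eps = χ'.eps →
        χ ∈ Function.update κ z Y v → χ' ∈ Function.update κ z Y v := by
      intro v χ χ' e
      by_cases hv : v = z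
      · subst hv
        rw [Function.update_self]
        exact fun hχ => Eq.trans hχ e
      · rw [Function.update_of_ne hv]
        exact hκ v χ χ' e
    have hsub := subst_simulSubst
      (χ := nu z (simulSubst (Function.update σ z (var z)) φ)) z φ σ
      fun v => (hσ v).imp_right fun ⟨hv, _⟩ => hv.1
    have hmem := ClosedGuarded.unfold_mem h'
    have hY : Y ⊆ sem (exprCoalgebra V M) κ (nu z φ) := by
      apply subset_sem_nu
      intro χ hχ
      -- It is enough to treat the unfolding, which is the instance of `φ` sending `z` to an element
      -- of `Y`.
      refine mem_sem_of_str_eq _ φ _ hκY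
        (x := ClosedGuarded.unfold z (simulSubst (Function.update σ z (var z)) φ) h') ?_ ?_
      · exact (ClosedGuarded.eps_nu z _ h').symm.trans hχ
      · have := ih (Function.update σ z (nu z (simulSubst (Function.update σ z (var z)) φ)))
          (Function.update κ z Y) hκY ?_ (hsub ▸ hmem)
        · exact mem_of_val_eq hsub.symm this
        · intro v
          by_cases hv : v = z
          · subst hv
            rw [Function.update_self, Function.update_self]
            exact Or.inr ⟨h', rfl⟩
          · rw [Function.update_of_ne hv, Function.update_of_ne hv]
            exact hσ v
    exact hY rfl
  | modal l args ih =>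
    refine M.monotone l _ _ _ ?_ (ClosedGuarded.eps_modal l _ h)
    rintro i _ rfl
    exact ih i σ κ hκ hσ _

/-- The truth lemma. -/
theorem mem_sem_exprCoalgebra (φ : ClosedGuarded V M) (κ : V → Set (exprCoalgebra V M).V) :
    φ ∈ sem (exprCoalgebra V M) κ φ.1 := by
  obtain ⟨φ, hφ⟩ := φ
  -- The full valuation is trivially saturated.
  rw [sem_eq_of_closed _ hφ.1 κ fun _ => Set.univ]
  have := simulSubst_mem_sem φ var (fun _ => Set.univ) (fun _ _ _ _ _ => trivial)
    (fun _ => Or.inl rfl) (by rwa [simulSubst_var])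
  exact mem_of_val_eq (simulSubst_var φ) this

/-! ### Satisfaction versus behavioural equivalence -/

theorem mem_sem_of_behaviourallyEquivalent {C D : Endofunctor.Coalgebra T} {φ : Expr V M}
    (hφ : φ.Closed) (κ : V → Set C.V) (κ' : V → Set D.V) {x : C.V} {y : D.V}
    (hxy : BehaviourallyEquivalent x y) (hy : y ∈ sem D κ' φ) : x ∈ sem C κ φ := by
  obtain ⟨E, f, g, hfg⟩ := hxy
  rw [sem_eq_of_closed D hφ κ' fun v => (fun y : D.V => g.f y) ⁻¹' ∅, sem_preimage g φ] at hy
  rw [sem_eq_of_closed C hφ κ fun v => (fun x : C.V => f.f x) ⁻¹' ∅, sem_preimage f φ]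
  simpa only [Set.mem_preimage, hfg] using hy

/-- By naturality and monotonicity, both sides lie in the lifting at the singletons `{q φᵢ}`, which
has one element. A top-level `ν` is unfolded first, changing neither semantics nor `ε`. -/
theorem map_str_eq_map_eps {C : Endofunctor.Coalgebra T} (κ : V → Set C.V) {Q : Type u}
    (p : C.V ⟶ Q) (q : ClosedGuarded V M ⟶ Q)
    (hpq : ∀ x (φ : ClosedGuarded V M), x ∈ sem C κ φ.1 → p x = q φ)
    (φ : ClosedGuarded V M) (x : C.V) (hx : x ∈ sem C κ φ.1) :
    T.map p (C.str x) = T.map q φ.eps := by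
  induction φ using ClosedGuarded.eps.induct with
  | case1 l args h =>
    obtain ⟨t, ht⟩ := M.preservesSingletons l Q fun i => q (ClosedGuarded.arg l args h i)
    have h₁ : T.map p (C.str x) ∈
        (M.lifting l).app Q fun i => {q (ClosedGuarded.arg l args h i)} := by
      change C.str x ∈ (fun t : T.obj C.V => T.map p t) ⁻¹' _
      rw [← (M.lifting l).naturality p]
      exact M.monotone l _ _ _ (fun i y hy => hpq y (ClosedGuarded.arg l args h i) hy) hx
    have h₂ : T.map q (ClosedGuarded.eps ⟨modal l args, h⟩) ∈
        (M.lifting l).app Q fun i => {q (ClosedGuarded.arg l args h i)} := by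
      change _ ∈ (fun t : T.obj (ClosedGuarded V M) => T.map q t) ⁻¹' _
      rw [← (M.lifting l).naturality q]
      refine M.monotone l _ _ _ ?_ (ClosedGuarded.eps_modal l args h)
      rintro i _ rfl
      rfl
    rw [ht] at h₁ h₂
    exact Eq.trans h₁ (Eq.symm h₂)
  | case2 z φ h ih =>
    rw [ClosedGuarded.eps_nu]
    apply ih
    change x ∈ sem C κ (subst (nu z φ) z φ)
    rwa [sem_subst C h.1, sem_nu_unfold]

theorem behaviourallyEquivalent_of_mem_sem {C : Endofunctor.Coalgebra T} (κ : V → Set C.V)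
    {x : C.V} {φ : ClosedGuarded V M} (hx : x ∈ sem C κ φ.1) :
    BehaviourallyEquivalent (C := C) (D := exprCoalgebra V M) x φ := by
  -- `R` need not be an equivalence relation: the structure map on the quotient only has to respect
  -- the generating pairs.
  let R : C.V ⊕ ClosedGuarded V M → C.V ⊕ ClosedGuarded V M → Prop
    | .inl x, .inr φ => x ∈ sem C κ φ.1
    | _, _ => False
  let p : C.V ⟶ Quot R := TypeCat.ofHom fun x => Quot.mk R (.inl x)
  let q : ClosedGuarded V M ⟶ Quot R := TypeCat.ofHom fun φ => Quot.mk R (.inr φ)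
  have hpq : ∀ x (φ : ClosedGuarded V M), x ∈ sem C κ φ.1 → p x = q φ :=
    fun x φ h => Quot.sound (r := R) (a := .inl x) (b := .inr φ) h
  let s : C.V ⊕ ClosedGuarded V M → T.obj (Quot R) :=
    Sum.elim (fun x => T.map p (C.str x)) fun φ => T.map q φ.eps
  have hs : ∀ a b, R a b → s a = s b := by
    rintro (x | φ) (y | ψ) h
    · exact h.elim
    · exact map_str_eq_map_eps κ p q hpq ψ x h
    · exact h.elim
    · exact h.elim
  let E : Endofunctor.Coalgebra T := ⟨Quot R, TypeCat.ofHom (Quot.lift s hs)⟩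
  exact ⟨E, ⟨p, by ext x; rfl⟩, ⟨q, by ext φ; rfl⟩, hpq x φ hx⟩

end CoalgExpr

theorem mainTheorem4 {T : Type u ⥤ Type u} (V : Type u) [DecidableEq V]
    (M : CoalgExpr.Modalities T) (hM : CoalgExpr.StronglyExpressive M.liftings) :
    (∀ (φ : CoalgExpr.ClosedGuarded V M) (C : Endofunctor.Coalgebra T) (κ : V → Set C.V)
        (x : C.V),
      x ∈ CoalgExpr.Expr.sem C κ φ.1 ↔
        CoalgExpr.BehaviourallyEquivalent (C := C) (D := CoalgExpr.exprCoalgebra V M) x φ) ∧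
    (∀ (φ : CoalgExpr.ClosedGuarded V M) (κ : V → Set (CoalgExpr.exprCoalgebra V M).V),
      φ ∈ CoalgExpr.Expr.sem (CoalgExpr.exprCoalgebra V M) κ φ.1) :=
  ⟨fun φ _ κ _ =>
    ⟨CoalgExpr.behaviourallyEquivalent_of_mem_sem κ, fun h =>
      CoalgExpr.mem_sem_of_behaviourallyEquivalent φ.2.1 κ (fun _ => ∅) h
        (CoalgExpr.mem_sem_exprCoalgebra φ _)⟩,
    CoalgExpr.mem_sem_exprCoalgebra⟩
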